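/- Let $m,n\in\mathbb{Z}$ be square-free with $m\equiv 3 \pmod 4$ and $n\equiv 2\pmod 4$. Put $d=\gcd(m,n)>0$, $k=mn/d^2$ and $L=\mathbb{Q}(\sqrt m,\sqrt n)$, so that $L/\mathbb{Q}$ is biquadratic. Let $G=\mathrm{Gal}(L/\mathbb{Q})=\{1,\sigma,\tau,\sigma\tau\}$, where $$\sigma(\sqrt m)=-\sqrt m,\quad \sigma(\sqrt n)=\sqrt n,\quad \tau(\sqrt m)=\sqrt m,\quad \tau(\sqrt n)=-\sqrt n .$$ Let $\lambda:G\to\mathrm{Perm}(G)$ be the left regular representation and define the regular subgroups $N_1,N_2,N_3$ of $\mathrm{Perm}(G)$, normalized by $\lambda(G)$, by $$N_1=\langle \lambda(\tau),\,(1,\sigma\tau,\tau,\sigma)\rangle,\quad N_2=\langle \lambda(\sigma),\,(1,\sigma\tau,\sigma,\tau)\rangle,\quad N_3=\langle \lambda(\sigma\tau),\,(1,\tau,\sigma\tau,\sigma)\rangle .$$ Let $H_i=L[N_i]^G$ be the three non-classical Hopf-Galois structures on $L/\mathbb{Q}$; here $G$ acts on $L$ by Galois automorphisms and on $N_i$ by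 conjugation through $\lambda$, and $H_i$ acts on $L$ by $\left(\sum_{\eta\in N_i} c_\eta\,\eta\right)\cdot x=\sum_{\eta\in N_i} c_\eta\,(\eta^{-1}(1))(x)$. (Thus $H_1,H_2,H_3$ are the structures corresponding to $\sqrt m,\sqrt n,\sqrt k$.) Let $\mathfrak{A}_{H_i}=\{h\in H_i : h\cdot\mathcal{O}_L\subseteq\mathcal{O}_L\}$ be the associated order of $\mathcal{O}_L$ in $H_i$. Then: 1. If $m$ and $n$ are coprime or $m$ divides $n$, then $\mathcal{O}_L$ is free (of rank one) as an $\mathfrak{A}_{H_1}$-module. 2. If $n=2d$ or $n=-2d$, then $\mathcal{O}_L$ is free (of rank one) as an $\mathfrak{A}_{H_2}$-module and as an $\mathfrak{A}_{H_3}$-module. -/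

import Mathlib

/-! Hopf-Galois structures on a finite Galois extension `L/K` with group `G = Gal(L/K)`, in the form
given by Greither and Pareigis: a regular subgroup `N` of `Perm(G)` normalized by the left
translations `lam g` gives the `K`-algebra `H = L[N]^G`, where `G` acts on `L` by the Galois action
and on `N` by conjugation with left translations, and `H` acts on `L` by
`(∑ c_η η) • x = ∑ c_η * (η⁻¹ 1) x`. -/

noncomputable section

namespace HopfGalois

/-- The left regular representation `G → Perm(G)`, `g ↦ (h ↦ g * h)`. -/
def lam (G : Type*) [Group G] : G →* Equiv.Perm G := MulAction.toPermHom G G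

section Structure

variable (K L : Type*) [Field K] [Field L] [Algebra K L]

/-- The action of `g ∈ Gal(L/K)` on `L[Perm(Gal(L/K))]`: the Galois action on the coefficients and
conjugation by `lam g` on the permutations. -/
def galConj (g : L ≃ₐ[K] L) :
    MonoidAlgebra L (Equiv.Perm (L ≃ₐ[K] L)) →+* MonoidAlgebra L (Equiv.Perm (L ≃ₐ[K] L)) :=
  (MonoidAlgebra.mapRingHom _ (g : L →+* L)).comp
    (MonoidAlgebra.mapDomainRingHom L (MulAut.conj (lam (L ≃ₐ[K] L) g)).toMonoidHom)

theorem galConj_single (g : L ≃ₐ[K] L) (η : Equiv.Perm (L ≃ₐ[K] L)) (c : L) :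
    galConj K L g (MonoidAlgebra.single η c) =
      MonoidAlgebra.single (lam _ g * η * (lam _ g)⁻¹) (g c) := by
  simp [galConj]

/-- The `K`-algebra `L[N]^G` of elements of the group algebra `L[N]` (viewed inside `L[Perm(G)]`)
that are fixed by `G = Gal(L/K)`. -/
def fixedAlgebra (N : Subgroup (Equiv.Perm (L ≃ₐ[K] L))) :
    Subalgebra K (MonoidAlgebra L (Equiv.Perm (L ≃ₐ[K] L))) :=
  (MonoidAlgebra.mapDomainAlgHom K L N.subtype).range ⊓
  { carrier := {x | ∀ g : L ≃ₐ[K] L, galConj K L g x = x}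
    mul_mem' := fun {a b} ha hb g => by rw [map_mul, ha g, hb g]
    add_mem' := fun {a b} ha hb g => by rw [map_add, ha g, hb g]
    algebraMap_mem' := fun r g => by
      rw [MonoidAlgebra.coe_algebraMap]
      simp [galConj_single] }

/-- The additive map `L[Perm(G)] → End_K(L)` sending `c η` to `x ↦ c * (η⁻¹ 1) x`. -/
def evalEnd : MonoidAlgebra L (Equiv.Perm (L ≃ₐ[K] L)) →+ Module.End K L :=
  MonoidAlgebra.liftNC (Algebra.lmul K L : L →+ Module.End K L)
    (fun η => (η⁻¹ 1 : L ≃ₐ[K] L).toLinearMap)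

theorem evalEnd_single (η : Equiv.Perm (L ≃ₐ[K] L)) (c x : L) :
    evalEnd K L (MonoidAlgebra.single η c) x = c * (η⁻¹ 1 : L ≃ₐ[K] L) x := by
  simp [evalEnd]

theorem evalEnd_single_mul (η : Equiv.Perm (L ≃ₐ[K] L)) (c : L)
    (y : MonoidAlgebra L (Equiv.Perm (L ≃ₐ[K] L))) :
    evalEnd K L (MonoidAlgebra.single η c * galConj K L (η⁻¹ 1) y) =
      evalEnd K L (MonoidAlgebra.single η c) * evalEnd K L y := by
  induction y using MonoidAlgebra.induction_linear with
  | zero => simp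
  | add a b ha hb => simp only [map_add, mul_add, ha, hb]
  | single ζ e =>
    ext x
    rw [galConj_single, MonoidAlgebra.single_mul_single, Module.End.mul_apply]
    simp only [evalEnd_single, map_mul]
    have h : (η * (lam _ (η⁻¹ 1) * ζ * (lam _ (η⁻¹ 1))⁻¹))⁻¹ 1 = η⁻¹ 1 * ζ⁻¹ 1 := by
      simp [mul_inv_rev, Equiv.Perm.mul_apply, lam]
    rw [h, AlgEquiv.mul_apply, mul_assoc]

/-- The representation of `H = L[N]^G` on `L`. -/
def rho (N : Subgroup (Equiv.Perm (L ≃ₐ[K] L))) : fixedAlgebra K L N →+* Module.End K L where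
  toFun h := evalEnd K L h.1
  map_zero' := by simp
  map_add' a b := by simp
  map_one' := by
    ext x
    change evalEnd K L (1 : MonoidAlgebra L (Equiv.Perm (L ≃ₐ[K] L))) x = x
    rw [MonoidAlgebra.one_def, evalEnd_single]
    simp
  map_mul' a b := by
    obtain ⟨a, ha⟩ := a
    obtain ⟨b, -, hb⟩ := b
    change evalEnd K L (a * b) = evalEnd K L a * evalEnd K L b
    clear ha
    induction a using MonoidAlgebra.induction_linear with
    | zero => simp
    | add p q hp hq => simp only [map_add, add_mul, hp, hq]
    | single η c => rw [← evalEnd_single_mul, hb (η⁻¹ 1)]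

end Structure

section Order

variable (L : Type*) [Field L] [NumberField L]

/-- The associated order `{h ∈ H | h • 𝓞_L ⊆ 𝓞_L}` of the ring of integers of `L` in the algebra
`H = L[N]^G`, for the extension `L/ℚ`. -/
def assocOrder (N : Subgroup (Equiv.Perm (L ≃ₐ[ℚ] L))) : Subring (fixedAlgebra ℚ L N) where
  carrier := {h | ∀ x : L, IsIntegral ℤ x → IsIntegral ℤ (rho ℚ L N h x)}
  mul_mem' {a b} ha hb x hx := by
    rw [map_mul]
    exact ha _ (hb x hx)
  one_mem' x hx := by simpa using hx
  add_mem' {a b} ha hb x hx := by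
    rw [map_add]
    exact (ha x hx).add (hb x hx)
  zero_mem' x hx := by simpa using isIntegral_zero
  neg_mem' {a} ha x hx := by
    rw [map_neg]
    exact (ha x hx).neg

/-- The ring of integers as a module over the associated order, with the action of `H` on `L`. -/
instance assocOrderModule (N : Subgroup (Equiv.Perm (L ≃ₐ[ℚ] L))) :
    Module (assocOrder L N) (NumberField.RingOfIntegers L) where
  smul h x := ⟨rho ℚ L N h.1 x, h.2 x x.2⟩
  one_smul x := by
    apply Subtype.ext
    change rho ℚ L N 1 (x : L) = x
    simp
  mul_smul a b x := by
    apply Subtype.ext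
    change rho ℚ L N (a.1 * b.1) (x : L) = rho ℚ L N a.1 (rho ℚ L N b.1 x)
    simp
  smul_zero a := by
    apply Subtype.ext
    change rho ℚ L N a.1 (0 : L) = 0
    simp
  smul_add a x y := by
    apply Subtype.ext
    change rho ℚ L N a.1 ((x : L) + y) = rho ℚ L N a.1 x + rho ℚ L N a.1 y
    simp
  add_smul a b x := by
    apply Subtype.ext
    change rho ℚ L N (a.1 + b.1) (x : L) = rho ℚ L N a.1 x + rho ℚ L N b.1 x
    simp
  zero_smul x := by
    apply Subtype.ext
    change rho ℚ L N 0 (x : L) = 0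
    simp

theorem coe_assocOrder_smul (N : Subgroup (Equiv.Perm (L ≃ₐ[ℚ] L))) (h : assocOrder L N)
    (x : NumberField.RingOfIntegers L) :
    ((h • x : NumberField.RingOfIntegers L) : L) = rho ℚ L N h.1 x := rfl

/-- `𝓞_L` is free of rank one over the associated order in `L[N]^G`. -/
def IsAssocOrderFree (N : Subgroup (Equiv.Perm (L ≃ₐ[ℚ] L))) : Prop :=
  Nonempty (Module.Basis Unit (assocOrder L N) (NumberField.RingOfIntegers L))

end Order

section Nonclassical

open Classical in
/-- For a Klein four-group `G = {1, σ, τ, στ}`, the cyclic regular subgroup of `Perm(G)` attached to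
`T = ⟨τ⟩`. It is generated by `μ = lam τ` and the 4-cycle `η = (1, στ, τ, σ)`. -/
def nonclassicalSubgroup {G : Type*} [Group G] (σ τ : G) : Subgroup (Equiv.Perm G) :=
  Subgroup.closure {lam G τ, List.formPerm [1, σ * τ, τ, σ]}

end Nonclassical

end HopfGalois

end

/-! An order acting on `𝓞_L` has it as a free module of rank one as soon as some `g` reaches every
integer `x` as `h · g` with `h` in the order. Uniqueness of `h` is automatic: `N` is commutative, so
an `h` that kills `g` kills all of `𝓞_L`, hence `L`, and independence of characters gives `h = 0`
(`isAssocOrderFree_of_generator`).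

The group `N` is cyclic of order 4, generated by `η` with `η² = μ = λ(τ')`. Conjugation by `λ(σ')`
inverts `η`, and conjugation by `λ(τ')` fixes it. If `t` is a square root with `σ' t = -t` and `τ' t
= t`, the elements `a + b μ + (p + q t) η + (p - q t) η⁻¹` with rational `a, b, p, q` are therefore
fixed by `G`. Such an element multiplies `1` and `t` by `a + b + 2p` and `a + b - 2p`. On the `-1`
eigenspace of `τ'`, spanned by the other two square roots, it acts as `(a - b) + 2q J` with `J = t
σ'`, and `J` exchanges those two roots up to an integer factor.

With `m = d m'`, `n = d n'` and `u = r s / d`, an integral basis is `1, r, s, (s + u) / 2`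
(`isIntegral_iff`). The arithmetic hypotheses make one factor of `J` small: `d = 1` or `m' = ±1` for
the first structure, `n' = ±2` for the other two. An explicit `g` then works: each equation `h · g =
x` is solved by hand, and `h` is checked to preserve `𝓞_L` on the four basis elements. -/

namespace HopfGalois

/-! ### Freeness from a generator -/

section Freeness

variable {K L : Type*} [Field K] [Field L] [Algebra K L]

/-- An element of `L[N]` that acts as zero on `L` vanishes, when `N` acts freely on `1`. -/
theorem eq_zero_of_evalEnd_eq_zero {N : Subgroup (Equiv.Perm (L ≃ₐ[K] L))}
    (hN : ∀ η ∈ N, ∀ ζ ∈ N, η 1 = ζ 1 → η = ζ) (z : MonoidAlgebra L N)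
    (hz : evalEnd K L (MonoidAlgebra.mapDomainAlgHom K L N.subtype z) = 0) : z = 0 := by
  let e : N → (L →* L) := fun η => ((η.1⁻¹ 1 : L ≃ₐ[K] L) : L →* L)
  have he : Function.Injective e := by
    intro η ζ h
    have h1 : (η.1⁻¹ 1 : L ≃ₐ[K] L) = ζ.1⁻¹ 1 := by
      ext x
      exact DFunLike.congr_fun h x
    exact Subtype.ext (inv_injective (hN _ (N.inv_mem η.2) _ (N.inv_mem ζ.2) h1))
  -- Dedekind: the distinct automorphisms `η⁻¹ 1` are linearly independent over `L`.
  have hlin := (linearIndependent_monoidHom L L).comp e he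
  rw [linearIndependent_iff] at hlin
  have key : ∀ (y : MonoidAlgebra L N) (x : L),
      evalEnd K L (MonoidAlgebra.mapDomainAlgHom K L N.subtype y) x =
        Finsupp.linearCombination L ((fun f : L →* L => (f : L → L)) ∘ e) y.coeff x := by
    intro y x
    induction y using MonoidAlgebra.induction_linear with
    | zero => simp
    | add a b ha hb => simp only [map_add, LinearMap.add_apply, ha, hb, MonoidAlgebra.coeff_add,
        Pi.add_apply]
    | single η c =>
      rw [MonoidAlgebra.mapDomainAlgHom_apply, MonoidAlgebra.mapDomain_single, evalEnd_single]
      simp [e, Finsupp.linearCombination_single]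
  have h0 := hlin z.coeff (by
    funext x
    rw [← key, hz]
    rfl)
  exact MonoidAlgebra.coeff_injective h0

/-- A commutative group of permutations that moves `1` to every point acts freely on `1`. -/
theorem eq_of_apply_one_eq {G : Type*} [Group G] {N : Subgroup (Equiv.Perm G)}
    (hcomm : ∀ η ∈ N, ∀ ζ ∈ N, η * ζ = ζ * η) (htrans : ∀ g : G, ∃ η ∈ N, η 1 = g) :
    ∀ η ∈ N, ∀ ζ ∈ N, η 1 = ζ 1 → η = ζ := by
  intro η hη ζ hζ h
  ext g
  obtain ⟨ν, hν, rfl⟩ := htrans g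
  rw [← Equiv.Perm.mul_apply, hcomm η hη ν hν, Equiv.Perm.mul_apply, h, ← Equiv.Perm.mul_apply,
    hcomm ν hν ζ hζ, Equiv.Perm.mul_apply]

theorem fixedAlgebra_mul_comm {N : Subgroup (Equiv.Perm (L ≃ₐ[K] L))}
    (hcomm : ∀ η ∈ N, ∀ ζ ∈ N, η * ζ = ζ * η) (a b : fixedAlgebra K L N) : a * b = b * a := by
  let _ : CommGroup N :=
    { (inferInstance : Group N) with mul_comm := fun a b => Subtype.ext (hcomm _ a.2 _ b.2) }
  obtain ⟨a, ⟨y, rfl⟩, -⟩ := a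
  obtain ⟨b, ⟨z, rfl⟩, -⟩ := b
  apply Subtype.ext
  change MonoidAlgebra.mapDomainAlgHom K L N.subtype y * MonoidAlgebra.mapDomainAlgHom K L N.subtype z
    = MonoidAlgebra.mapDomainAlgHom K L N.subtype z * MonoidAlgebra.mapDomainAlgHom K L N.subtype y
  rw [← map_mul, ← map_mul, mul_comm]

end Freeness

/-- If `N` is commutative and transitive, a generator of `𝓞_L` over the associated order is a
basis. -/
theorem isAssocOrderFree_of_generator {L : Type*} [Field L] [NumberField L]
    {N : Subgroup (Equiv.Perm (L ≃ₐ[ℚ] L))}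
    (hcomm : ∀ η ∈ N, ∀ ζ ∈ N, η * ζ = ζ * η) (htrans : ∀ g, ∃ η ∈ N, η 1 = g)
    (g : L) (hg : IsIntegral ℤ g)
    (hgen : ∀ x : L, IsIntegral ℤ x → ∃ h ∈ assocOrder L N, rho ℚ L N h g = x) :
    IsAssocOrderFree L N := by
  let γ : NumberField.RingOfIntegers L := ⟨g, hg⟩
  let f : assocOrder L N →ₗ[assocOrder L N] NumberField.RingOfIntegers L :=
    LinearMap.toSpanSingleton _ _ γ
  have hf : ∀ h : assocOrder L N, ((f h : NumberField.RingOfIntegers L) : L) = rho ℚ L N h.1 g :=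
    fun h => rfl
  have hsurj : Function.Surjective f := by
    intro x
    obtain ⟨h, hA, hx⟩ := hgen x x.2
    exact ⟨⟨h, hA⟩, Subtype.ext hx⟩
  have hinj : Function.Injective f := by
    rw [injective_iff_map_eq_zero]
    intro h h0
    have hg0 : rho ℚ L N h.1 g = 0 := by rw [← hf, h0]; rfl
    -- Write `x = k · g`; then `h · x = k · (h · g) = 0` because `H` is commutative.
    have hint : ∀ x : L, IsIntegral ℤ x → rho ℚ L N h.1 x = 0 := by
      intro x hx
      obtain ⟨k, -, rfl⟩ := hgen x hx
      rw [← Module.End.mul_apply, ← map_mul, fixedAlgebra_mul_comm hcomm, map_mul,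
        Module.End.mul_apply, hg0, map_zero]
    have hall : rho ℚ L N h.1 = 0 := by
      ext x
      obtain ⟨c, hc, hcx⟩ := ((IsFractionRing.isAlgebraic_iff ℤ ℚ L).2
        (Algebra.IsAlgebraic.isAlgebraic x)).exists_integral_multiple
      have h1 := hint _ hcx
      rw [map_zsmul] at h1
      exact (smul_eq_zero.mp h1).resolve_left hc
    obtain ⟨⟨k, ⟨y, rfl⟩, hk⟩, hA⟩ := h
    have := eq_zero_of_evalEnd_eq_zero (eq_of_apply_one_eq hcomm htrans) y hall
    subst this
    apply Subtype.ext
    apply Subtype.ext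
    exact map_zero (MonoidAlgebra.mapDomainAlgHom ℚ L N.subtype)
  exact ⟨(Module.Basis.singleton Unit (assocOrder L N)).map
    (LinearEquiv.ofBijective f ⟨hinj, hsurj⟩)⟩

/-! ### Klein four-groups and the cyclic regular subgroup -/

/-- `σ` and `τ` are two distinct non-trivial elements of the Klein four-group `G`. -/
structure IsKleinPair {G : Type*} [Group G] (σ τ : G) : Prop where
  sq_left : σ * σ = 1
  sq_right : τ * τ = 1
  comm : σ * τ = τ * σ
  left_ne_one : σ ≠ 1
  right_ne_one : τ ≠ 1
  ne : σ ≠ τ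
  cover : ∀ g : G, g = 1 ∨ g = σ ∨ g = τ ∨ g = σ * τ

namespace IsKleinPair

section Group

variable {G : Type*} [Group G] {σ τ : G}

theorem swap (h : IsKleinPair σ τ) : IsKleinPair τ σ where
  sq_left := h.sq_right
  sq_right := h.sq_left
  comm := h.comm.symm
  left_ne_one := h.right_ne_one
  right_ne_one := h.left_ne_one
  ne := h.ne.symm
  cover g := by
    rw [← h.comm]
    have := h.cover g
    tauto

theorem left_mul_mul (h : IsKleinPair σ τ) : σ * (σ * τ) = τ := by
  rw [← mul_assoc, h.sq_left, one_mul]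

theorem right_mul_mul (h : IsKleinPair σ τ) : τ * (σ * τ) = σ := by
  rw [h.comm, ← mul_assoc, h.sq_right, one_mul]

theorem mul_mul_left (h : IsKleinPair σ τ) : σ * τ * σ = τ := by
  rw [h.comm, mul_assoc, h.sq_left, mul_one]

theorem mul_mul_right (h : IsKleinPair σ τ) : σ * τ * τ = σ := by
  rw [mul_assoc, h.sq_right, mul_one]

theorem mul_ne_one (h : IsKleinPair σ τ) : σ * τ ≠ 1 := fun e => by
  apply h.ne
  rw [← h.mul_mul_right, e, one_mul]

/-- Lets the third structure be treated as an instance of the first, with `στ` in the role of `τ`.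
-/
theorem left_mul (h : IsKleinPair σ τ) : IsKleinPair σ (σ * τ) where
  sq_left := h.sq_left
  sq_right := by rw [← mul_assoc, h.mul_mul_left, h.sq_right]
  comm := by rw [h.left_mul_mul, h.mul_mul_left]
  left_ne_one := h.left_ne_one
  right_ne_one := h.mul_ne_one
  ne e := h.right_ne_one (by simpa using e)
  cover g := by
    rw [h.left_mul_mul]
    have := h.cover g
    tauto

open Classical in
/-- The 4-cycle `(1, στ, τ, σ)`. -/
noncomputable def cycle (σ τ : G) : Equiv.Perm G := List.formPerm [1, σ * τ, τ, σ]

theorem cycle_apply (h : IsKleinPair σ τ) :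
    cycle σ τ 1 = σ * τ ∧ cycle σ τ (σ * τ) = τ ∧ cycle σ τ τ = σ ∧ cycle σ τ σ = 1 := by
  classical
  have h1 := h.left_ne_one
  have h2 := h.right_ne_one
  have hnd : [1, σ * τ, τ, σ].Nodup := by
    simp [h1, h2, h.ne.symm, h1.symm, h2.symm, h.mul_ne_one.symm]
  have e (i : ℕ) (hi : i < 4) := List.formPerm_apply_getElem [1, σ * τ, τ, σ] hnd i hi
  have hc : cycle σ τ = List.formPerm [1, σ * τ, τ, σ] := by
    unfold cycle
    congr
  rw [hc]
  exact ⟨e 0 (by simp), e 1 (by simp), e 2 (by simp), by simp⟩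

theorem perm_ext (h : IsKleinPair σ τ) {p q : Equiv.Perm G} (h1 : p 1 = q 1) (h2 : p σ = q σ)
    (h3 : p τ = q τ) (h4 : p (σ * τ) = q (σ * τ)) : p = q := by
  ext g
  rcases h.cover g with rfl | rfl | rfl | rfl <;> assumption

theorem lam_apply (g x : G) : lam G g x = g * x := rfl

theorem cycle_mul_cycle (h : IsKleinPair σ τ) : cycle σ τ * cycle σ τ = lam G τ := by
  obtain ⟨e0, e1, e2, e3⟩ := h.cycle_apply
  apply h.perm_ext <;>
    simp [Equiv.Perm.mul_apply, lam_apply, e0, e1, e2, e3, h.sq_right, h.right_mul_mul, ← h.comm]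

/-- The dihedral relation between `λ(σ)` and the 4-cycle, in an inverse-free form that can be
checked on the four points. -/
theorem cycle_mul_lam_mul_cycle (h : IsKleinPair σ τ) :
    cycle σ τ * lam G σ * cycle σ τ = lam G σ := by
  obtain ⟨e0, e1, e2, e3⟩ := h.cycle_apply
  apply h.perm_ext <;>
    simp [Equiv.Perm.mul_apply, lam_apply, e0, e1, e2, e3, h.sq_left, h.left_mul_mul]

theorem conj_lam_left (h : IsKleinPair σ τ) :
    lam G σ * cycle σ τ * (lam G σ)⁻¹ = (cycle σ τ)⁻¹ := by
  rw [mul_inv_eq_iff_eq_mul, eq_inv_mul_iff_mul_eq, ← mul_assoc, h.cycle_mul_lam_mul_cycle]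

theorem conj_lam_right (h : IsKleinPair σ τ) :
    lam G τ * cycle σ τ * (lam G τ)⁻¹ = cycle σ τ := by
  rw [mul_inv_eq_iff_eq_mul, ← h.cycle_mul_cycle, mul_assoc]

theorem cycle_inv_apply_one (h : IsKleinPair σ τ) : (cycle σ τ)⁻¹ 1 = σ := by
  rw [Equiv.Perm.inv_eq_iff_eq, h.cycle_apply.2.2.2]

theorem lam_mem (σ τ : G) : lam G τ ∈ nonclassicalSubgroup σ τ :=
  Subgroup.subset_closure (by simp)

theorem cycle_mem (σ τ : G) : cycle σ τ ∈ nonclassicalSubgroup σ τ :=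
  Subgroup.subset_closure (by simp [cycle])

theorem nonclassicalSubgroup_comm (h : IsKleinPair σ τ) :
    ∀ η ∈ nonclassicalSubgroup σ τ, ∀ ζ ∈ nonclassicalSubgroup σ τ, η * ζ = ζ * η := by
  have hc : lam G τ * cycle σ τ = cycle σ τ * lam G τ := by
    rw [← h.cycle_mul_cycle, mul_assoc]
  have := Subgroup.isMulCommutative_closure (k := {lam G τ, cycle σ τ}) (by
    rintro x (rfl | rfl) y (rfl | rfl)
    · rfl
    · exact hc
    · exact hc.symm
    · rfl)
  intro η hη ζ hζ
  exact congrArg Subtype.val (this.is_comm.comm ⟨η, hη⟩ ⟨ζ, hζ⟩)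

theorem nonclassicalSubgroup_transitive (h : IsKleinPair σ τ) (g : G) :
    ∃ η ∈ nonclassicalSubgroup σ τ, η 1 = g := by
  rcases h.cover g with rfl | rfl | rfl | rfl
  · exact ⟨1, Subgroup.one_mem _, rfl⟩
  · exact ⟨_, Subgroup.inv_mem _ (cycle_mem g τ), h.cycle_inv_apply_one⟩
  · exact ⟨_, lam_mem σ g, mul_one g⟩
  · exact ⟨_, cycle_mem σ τ, h.cycle_apply.1⟩

end Group

/-! ### Explicit elements of the Hopf algebra -/

section Field

variable {L : Type*} [Field L] [NumberField L] {σ τ : L ≃ₐ[ℚ] L}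

/-- The element `a + b μ + (p + q t) η + (p - q t) η⁻¹` of `L[Perm(G)]`, where `μ = lam τ`. -/
noncomputable def element (σ τ : L ≃ₐ[ℚ] L) (t : L) (a b p q : ℚ) : MonoidAlgebra L (Equiv.Perm (L ≃ₐ[ℚ] L)) :=
  MonoidAlgebra.single 1 (a : L) + MonoidAlgebra.single (lam _ τ) (b : L) +
    MonoidAlgebra.single (cycle σ τ) (p + q * t) + MonoidAlgebra.single (cycle σ τ)⁻¹ (p - q * t)

theorem galConj_mul (g g' : L ≃ₐ[ℚ] L) (x : MonoidAlgebra L (Equiv.Perm (L ≃ₐ[ℚ] L))) :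
    galConj ℚ L (g * g') x = galConj ℚ L g (galConj ℚ L g' x) := by
  induction x using MonoidAlgebra.induction_linear with
  | zero => simp
  | add a b ha hb => simp only [map_add, ha, hb]
  | single η c => simp only [galConj_single, map_mul, mul_inv_rev, mul_assoc, AlgEquiv.mul_apply]

/-- `σ` swaps `η` with `η⁻¹` and also `p + q t` with `p - q t`, so it only permutes the last two
terms; `τ` fixes every term. -/
theorem element_mem (h : IsKleinPair σ τ) {t : L} (hσ : σ t = -t) (hτ : τ t = t) (a b p q : ℚ) :
    element σ τ t a b p q ∈ fixedAlgebra ℚ L (nonclassicalSubgroup σ τ) := by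
  refine ⟨?_, ?_⟩
  · have hs : ∀ η ∈ nonclassicalSubgroup σ τ, ∀ c : L, MonoidAlgebra.single η c ∈
        (MonoidAlgebra.mapDomainAlgHom ℚ L (nonclassicalSubgroup σ τ).subtype).range :=
      fun η hη c => ⟨MonoidAlgebra.single ⟨η, hη⟩ c, by simp⟩
    exact add_mem (add_mem (add_mem (hs _ (one_mem _) _) (hs _ (lam_mem σ τ) _))
      (hs _ (cycle_mem σ τ) _)) (hs _ (inv_mem (cycle_mem σ τ)) _)
  · have h1 : galConj ℚ L 1 (element σ τ t a b p q) = element σ τ t a b p q := by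
      simp [element, galConj_single]
    have h2 : galConj ℚ L σ (element σ τ t a b p q) = element σ τ t a b p q := by
      have hc : lam _ σ * lam _ τ * (lam _ σ)⁻¹ = lam _ τ := by
        rw [mul_inv_eq_iff_eq_mul, ← map_mul, ← map_mul, h.comm]
      have hi : lam _ σ * (cycle σ τ)⁻¹ * (lam _ σ)⁻¹ = cycle σ τ := by
        simpa [mul_assoc] using congrArg (·⁻¹) h.conj_lam_left
      simp only [element, map_add, galConj_single, hc, hi, h.conj_lam_left, mul_one,
        mul_inv_cancel, map_sub, map_mul, map_ratCast, hσ]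
      rw [add_assoc, add_assoc _ (MonoidAlgebra.single (cycle σ τ) _),
        add_comm (MonoidAlgebra.single (cycle σ τ)⁻¹ _)]
      congr 3 <;> ring
    have h3 : galConj ℚ L τ (element σ τ t a b p q) = element σ τ t a b p q := by
      have hi : lam _ τ * (cycle σ τ)⁻¹ * (lam _ τ)⁻¹ = (cycle σ τ)⁻¹ := by
        conv_rhs => rw [← h.conj_lam_right]
        group
      simp only [element, map_add, galConj_single, hi, h.conj_lam_right, mul_one,
        mul_inv_cancel, map_sub, map_mul, map_ratCast, hτ, mul_inv_cancel_right]
    intro g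
    rcases h.cover g with rfl | rfl | rfl | rfl
    · exact h1
    · exact h2
    · exact h3
    · rw [galConj_mul, h3, h2]

theorem evalEnd_element (h : IsKleinPair σ τ) (t : L) (a b p q : ℚ) (x : L) :
    evalEnd ℚ L (element σ τ t a b p q) x =
      a * x + b * τ x + (p + q * t) * σ x + (p - q * t) * σ (τ x) := by
  have hτ : (lam _ τ)⁻¹ 1 = τ := by
    rw [Equiv.Perm.inv_eq_iff_eq, lam_apply, h.sq_right]
  simp only [element, map_add, LinearMap.add_apply, evalEnd_single, hτ, h.cycle_inv_apply_one,
    inv_inv, h.cycle_apply.1, inv_one, Equiv.Perm.one_apply, AlgEquiv.one_apply,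
    AlgEquiv.mul_apply]

/-- Freeness of `𝓞_L` over the associated order, in terms of explicit elements of `H`. -/
theorem isAssocOrderFree (h : IsKleinPair σ τ) {t : L} (hσ : σ t = -t) (hτ : τ t = t)
    (g : L) (hg : IsIntegral ℤ g)
    (hgen : ∀ x : L, IsIntegral ℤ x → ∃ a b p q : ℚ,
      (∀ y, IsIntegral ℤ y →
        IsIntegral ℤ (a * y + b * τ y + (p + q * t) * σ y + (p - q * t) * σ (τ y))) ∧
      a * g + b * τ g + (p + q * t) * σ g + (p - q * t) * σ (τ g) = x) :
    IsAssocOrderFree L (nonclassicalSubgroup σ τ) := by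
  refine isAssocOrderFree_of_generator h.nonclassicalSubgroup_comm
    h.nonclassicalSubgroup_transitive g hg fun x hx => ?_
  obtain ⟨a, b, p, q, hint, hgx⟩ := hgen x hx
  refine ⟨⟨element σ τ t a b p q, h.element_mem hσ hτ a b p q⟩, fun y hy => ?_, ?_⟩
  · change IsIntegral ℤ (evalEnd ℚ L (element σ τ t a b p q) y)
    rw [h.evalEnd_element]
    exact hint y hy
  · change evalEnd ℚ L (element σ τ t a b p q) g = x
    rw [h.evalEnd_element]
    exact hgx

end Field

end IsKleinPair

end HopfGalois

/-! ### Integers of quadratic and biquadratic fields -/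

namespace HopfGalois

/-- Since `(m q)² = m N`, the number `m q` is an integer whose square is divisible by `m`;
squarefreeness makes `m` divide it. -/
theorem exists_int_of_squarefree_mul_sq {m : ℤ} (hm : Squarefree m) {q : ℚ} {N : ℤ}
    (h : m * q ^ 2 = N) : ∃ z : ℤ, q = z := by
  have hm0 : (m : ℚ) ≠ 0 := by exact_mod_cast hm.ne_zero
  have hint : IsIntegral ℤ ((m : ℚ) * q) := by
    refine IsIntegral.of_pow two_pos ?_
    have : ((m : ℚ) * q) ^ 2 = ((m * N : ℤ) : ℚ) := by
      push_cast
      rw [← h]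
      ring
    rw [this]
    exact isIntegral_algebraMap (x := m * N)
  obtain ⟨e, he⟩ := IsIntegrallyClosed.isIntegral_iff.mp hint
  have he' : (e : ℚ) = m * q := he
  have h2 : e ^ 2 = m * N := by
    have : ((e ^ 2 : ℤ) : ℚ) = ((m * N : ℤ) : ℚ) := by
      push_cast
      rw [he', ← h]
      ring
    exact_mod_cast this
  obtain ⟨f, rfl⟩ := (hm.dvd_pow_iff_dvd two_ne_zero).mp ⟨N, h2⟩
  refine ⟨f, mul_left_cancel₀ hm0 ?_⟩
  rw [← he']
  push_cast
  ring

theorem exists_eq_two_mul_of_zmod_four {a : ℤ} (h : ((2 * a : ℤ) : ZMod 4) = 0) : ∃ b, a = 2 * b := by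
  have := (ZMod.intCast_zmod_eq_zero_iff_dvd (2 * a) 4).mp h
  obtain ⟨b, hb⟩ := this
  push_cast at hb
  exact ⟨b, by omega⟩

section Quadratic

variable {L : Type*} [Field L] [NumberField L]

theorem exists_int_of_isIntegral {q : ℚ} {x : L} (h : IsIntegral ℤ x) (hx : q = x) :
    ∃ z : ℤ, q = z := by
  have h1 : IsIntegral ℤ (algebraMap ℚ L q) := by simpa [hx] using h
  rw [isIntegral_algebraMap_iff (algebraMap ℚ L).injective] at h1
  obtain ⟨z, hz⟩ := IsIntegrallyClosed.isIntegral_iff.mp h1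
  exact ⟨z, hz.symm⟩

omit [NumberField L] in
theorem isIntegral_intCast (z : ℤ) : IsIntegral ℤ (z : L) := by
  simpa using isIntegral_algebraMap (R := ℤ) (A := L) (x := z)

/-- The integers of `ℚ(√m)` for square-free `m ≡ 2, 3 mod 4`. -/
theorem exists_int_of_isIntegral_quadratic {m : ℤ} (hm : Squarefree m)
    (h4 : (m : ZMod 4) = 2 ∨ (m : ZMod 4) = 3) {t : L} (ht : t ^ 2 = m) (ρ : L ≃ₐ[ℚ] L)
    (hρ : ρ t = -t) {α β : ℚ} {x : L} (h : IsIntegral ℤ x)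
    (hx : α + β * t = x) :
    ∃ a b : ℤ, α = a ∧ β = b := by
  subst hx
  have hc : IsIntegral ℤ ((α : L) - β * t) := by
    have := h.map (ρ.toAlgHom.restrictScalars ℤ)
    simpa [hρ, ← sub_eq_add_neg] using this
  obtain ⟨A, hA⟩ : ∃ z : ℤ, 2 * α = z := by
    refine exists_int_of_isIntegral (h.add hc) ?_
    push_cast
    ring
  obtain ⟨N, hN⟩ : ∃ z : ℤ, α ^ 2 - m * β ^ 2 = z := by
    refine exists_int_of_isIntegral (h.mul hc) ?_
    push_cast
    linear_combination (β : L) ^ 2 * ht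
  obtain ⟨B, hB⟩ : ∃ z : ℤ, 2 * β = z := by
    apply exists_int_of_squarefree_mul_sq hm (N := A ^ 2 - 4 * N)
    push_cast
    rw [← hA, ← hN]
    ring
  have hAB : A ^ 2 - m * B ^ 2 = 4 * N := by
    have : ((A ^ 2 - m * B ^ 2 : ℤ) : ℚ) = ((4 * N : ℤ) : ℚ) := by
      push_cast
      rw [← hA, ← hN, ← hB]
      ring
    exact_mod_cast this
  have hz : (A : ZMod 4) ^ 2 - m * B ^ 2 = 0 := by
    have := congrArg (Int.cast : ℤ → ZMod 4) hAB
    push_cast at this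
    rw [this, show (4 : ZMod 4) = 0 from rfl, zero_mul]
  -- From trace `A = 2α` and norm `N` one has `A² - m B² = 4N` with `B = 2β`; modulo 4 this forces
  -- `A` and `B` to be even.
  have key : ∀ x y z : ZMod 4, (x = 2 ∨ x = 3) → y ^ 2 - x * z ^ 2 = 0 → 2 * y = 0 ∧ 2 * z = 0 := by
    decide
  obtain ⟨h1, h2⟩ := key _ _ _ h4 hz
  obtain ⟨a, rfl⟩ := exists_eq_two_mul_of_zmod_four (a := A) (by exact_mod_cast h1)
  obtain ⟨b, rfl⟩ := exists_eq_two_mul_of_zmod_four (a := B) (by exact_mod_cast h2)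
  push_cast at hA hB
  exact ⟨a, b, by linarith, by linarith⟩

end Quadratic

/-- `L = ℚ(r, s)` with `r ^ 2 = d m'`, `s ^ 2 = d n'` square-free, `d m' ≡ 3` and `d n' ≡ 2 mod 4`,
`u = r s / d`, and `σ`, `τ` are the automorphisms fixing `s`, `r` respectively. -/
structure IsBiquadratic {L : Type*} [Field L] [NumberField L] (d m' n' : ℤ) (r s u : L)
    (σ τ : L ≃ₐ[ℚ] L) : Prop where
  squarefree_left : Squarefree (d * m')
  squarefree_right : Squarefree (d * n')
  squarefree_mul : Squarefree (m' * n')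
  left_mod : (d : ZMod 4) * m' = 3
  right_mod : (d : ZMod 4) * n' = 2
  left_sq : r ^ 2 = (d : L) * m'
  right_sq : s ^ 2 = (d : L) * n'
  third_sq : u ^ 2 = (m' : L) * n'
  left_mul_right : r * s = d * u
  left_mul_third : r * u = m' * s
  right_mul_third : s * u = n' * r
  σ_left : σ r = -r
  σ_right : σ s = s
  σ_third : σ u = -u
  τ_left : τ r = r
  τ_right : τ s = -s
  τ_third : τ u = -u
  span : ∀ y : L, ∃ a b c e : ℚ, y = a + b * r + c * s + e * u

namespace IsBiquadratic

variable {L : Type*} [Field L] [NumberField L] {d m' n' : ℤ} {r s u : L} {σ τ : L ≃ₐ[ℚ] L}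

theorem mods (h : IsBiquadratic d m' n' r s u σ τ) :
    (m' : ZMod 4) * n' = 2 ∧ 2 * (n' : ZMod 4) = 0 ∧ (d : ZMod 4) + m' = 0 := by
  have key : ∀ x y z : ZMod 4, x * y = 3 → x * z = 2 → y * z = 2 ∧ 2 * z = 0 ∧ x + y = 0 := by
    decide
  exact key _ _ _ h.left_mod h.right_mod

theorem isIntegral_left (h : IsBiquadratic d m' n' r s u σ τ) : IsIntegral ℤ r :=
  IsIntegral.of_pow two_pos (by rw [h.left_sq]; exact (isIntegral_intCast d).mul (isIntegral_intCast m'))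

theorem isIntegral_right (h : IsBiquadratic d m' n' r s u σ τ) : IsIntegral ℤ s :=
  IsIntegral.of_pow two_pos (by rw [h.right_sq]; exact (isIntegral_intCast d).mul (isIntegral_intCast n'))

/-- The square is `n' (d + m') / 4 + (n' / 2) r`, which is integral because `n'` is even and `d m' ≡
3` modulo 4 forces `4 ∣ d + m'`. -/
theorem isIntegral_half (h : IsBiquadratic d m' n' r s u σ τ) : IsIntegral ℤ ((s + u) / 2) := by
  obtain ⟨-, h2, h3⟩ := h.mods
  obtain ⟨e, rfl⟩ := exists_eq_two_mul_of_zmod_four (a := n') (by exact_mod_cast h2)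
  obtain ⟨f, hf⟩ := (ZMod.intCast_zmod_eq_zero_iff_dvd (d + m') 4).mp (by exact_mod_cast h3)
  apply IsIntegral.of_pow two_pos
  have : ((s + u) / 2) ^ 2 = ((2 * e * f : ℤ) : L) + (e : L) * r := by
    have hf' : (d : L) + m' = 4 * f := by exact_mod_cast congrArg (Int.cast : ℤ → L) hf
    have a := h.right_sq
    have b := h.third_sq
    have c := h.right_mul_third
    push_cast at a b c ⊢
    linear_combination (a + b) / 4 + c / 2 + (e : L) / 2 * hf'
  rw [this]
  exact (isIntegral_intCast _).add ((isIntegral_intCast e).mul h.isIntegral_left)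

/-- `1, r, s, (s + u) / 2` is an integral basis. -/
theorem isIntegral_iff (h : IsBiquadratic d m' n' r s u σ τ) (y : L) :
    IsIntegral ℤ y ↔ ∃ a b c e : ℤ, y = a + b * r + c * s + e * ((s + u) / 2) := by
  constructor
  · intro hy
    obtain ⟨a, b, c, e, rfl⟩ := h.span y
    have hconj (ρ : L ≃ₐ[ℚ] L) := hy.map (ρ.toAlgHom.restrictScalars ℤ)
    obtain ⟨hk, h2, -⟩ := h.mods
    have hτ : IsIntegral ℤ ((a : L) + b * r - c * s - e * u) := by
      simpa [h.τ_left, h.τ_right, h.τ_third, ← sub_eq_add_neg] using hconj τ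
    have hσ : IsIntegral ℤ ((a : L) - b * r + c * s - e * u) := by
      simpa [h.σ_left, h.σ_right, h.σ_third, ← sub_eq_add_neg] using hconj σ
    have hστ : IsIntegral ℤ ((a : L) - b * r - c * s + e * u) := by
      simpa [h.σ_left, h.σ_right, h.σ_third, h.τ_left, h.τ_right, h.τ_third,
        ← sub_eq_add_neg] using hconj (σ * τ)
    -- The relative traces to the three quadratic subfields show that `2a, 2b, 2c, 2e` are integers.
    obtain ⟨A, B, hA, hB⟩ := exists_int_of_isIntegral_quadratic (α := 2 * a) (β := 2 * b)
      h.squarefree_left (Or.inr (by exact_mod_cast h.left_mod)) (by exact_mod_cast h.left_sq)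
      σ h.σ_left (hy.add hτ) (by push_cast; ring)
    obtain ⟨-, C, -, hC⟩ := exists_int_of_isIntegral_quadratic (α := 2 * a) (β := 2 * c)
      h.squarefree_right (Or.inl (by exact_mod_cast h.right_mod)) (by exact_mod_cast h.right_sq)
      τ h.τ_right (hy.add hσ) (by push_cast; ring)
    obtain ⟨-, D, -, hD⟩ := exists_int_of_isIntegral_quadratic (α := 2 * a) (β := 2 * e)
      h.squarefree_mul (Or.inl (by exact_mod_cast hk)) (by exact_mod_cast h.third_sq)
      σ h.σ_third (hy.add hστ) (by push_cast; ring)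
    -- The relative norm `y · τ y` to `ℚ(r)` supplies the remaining parity conditions.
    obtain ⟨X, Y, hX, hY⟩ := exists_int_of_isIntegral_quadratic
      (α := a ^ 2 + d * m' * b ^ 2 - d * n' * c ^ 2 - m' * n' * e ^ 2)
      (β := 2 * a * b - 2 * n' * c * e)
      h.squarefree_left (Or.inr (by exact_mod_cast h.left_mod)) (by exact_mod_cast h.left_sq)
      σ h.σ_left (hy.mul hτ) (by
        push_cast
        linear_combination (-(b : L) ^ 2) * h.left_sq + (c : L) ^ 2 * h.right_sq +
          (e : L) ^ 2 * h.third_sq + 2 * (c : L) * e * h.right_mul_third)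
    have e1 : A ^ 2 + d * m' * B ^ 2 - d * n' * C ^ 2 - m' * n' * D ^ 2 = 4 * X := by
      have : ((A ^ 2 + d * m' * B ^ 2 - d * n' * C ^ 2 - m' * n' * D ^ 2 : ℤ) : ℚ) =
          ((4 * X : ℤ) : ℚ) := by
        push_cast
        rw [← hA, ← hB, ← hC, ← hD, ← hX]
        ring
      exact_mod_cast this
    have e2 : A * B - n' * C * D = 2 * Y := by
      have : ((A * B - n' * C * D : ℤ) : ℚ) = ((2 * Y : ℤ) : ℚ) := by
        push_cast
        rw [← hA, ← hB, ← hC, ← hD, ← hY]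
        ring
      exact_mod_cast this
    have z1 := congrArg (Int.cast : ℤ → ZMod 4) e1
    have z2 := congrArg (fun x : ℤ => ((2 * x : ℤ) : ZMod 4)) e2
    push_cast at z1 z2
    rw [h.left_mod, h.right_mod, hk, show (4 : ZMod 4) = 0 from rfl, zero_mul] at z1
    have h40 : (4 : ZMod 4) = 0 := rfl
    -- Doubling `A B - n' C D = 2Y` removes the term in `n'`, which is even.
    have z3 : 2 * ((A : ZMod 4) * B) = 0 := by
      linear_combination z2 + (C : ZMod 4) * D * h2 +
        (Y : ZMod 4) * h40
    have key : ∀ x y z w : ZMod 4, x ^ 2 + 3 * y ^ 2 - 2 * z ^ 2 - 2 * w ^ 2 = 0 →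
        2 * (x * y) = 0 → 2 * x = 0 ∧ 2 * y = 0 ∧ 2 * (z - w) = 0 := by
      decide
    obtain ⟨k1, k2, k3⟩ := key _ _ _ _ z1 z3
    obtain ⟨A', rfl⟩ := exists_eq_two_mul_of_zmod_four (a := A) (by exact_mod_cast k1)
    obtain ⟨B', rfl⟩ := exists_eq_two_mul_of_zmod_four (a := B) (by exact_mod_cast k2)
    obtain ⟨C', hC'⟩ := exists_eq_two_mul_of_zmod_four (a := C - D) (by exact_mod_cast k3)
    have hCD : (C : ℚ) - D = 2 * C' := by exact_mod_cast congrArg (Int.cast : ℤ → ℚ) hC'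
    refine ⟨A', B', C', D, ?_⟩
    push_cast at hA hB
    obtain rfl : a = A' := by linarith
    obtain rfl : b = B' := by linarith
    obtain rfl : e = D / 2 := by linarith
    obtain rfl : c = C' + D / 2 := by linarith
    push_cast
    ring
  · rintro ⟨a, b, c, e, rfl⟩
    exact (((isIntegral_intCast a).add ((isIntegral_intCast b).mul h.isIntegral_left)).add
      ((isIntegral_intCast c).mul h.isIntegral_right)).add
      ((isIntegral_intCast e).mul h.isIntegral_half)

theorem isKleinPair (h : IsBiquadratic d m' n' r s u σ τ) : IsKleinPair σ τ := by
  have hr0 : r ≠ 0 := fun e => by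
    have := h.left_sq
    rw [e, zero_pow two_ne_zero] at this
    exact h.squarefree_left.ne_zero (by exact_mod_cast this.symm)
  have hs0 : s ≠ 0 := fun e => by
    have := h.right_sq
    rw [e, zero_pow two_ne_zero] at this
    exact h.squarefree_right.ne_zero (by exact_mod_cast this.symm)
  have hu : ∀ ρ : L ≃ₐ[ℚ] L, (d : L) * ρ u = ρ r * ρ s := fun ρ => by
    rw [← map_mul, h.left_mul_right, map_mul, map_intCast]
  have hd0 : (d : L) ≠ 0 := by
    exact_mod_cast left_ne_zero_of_mul h.squarefree_left.ne_zero
  have hext : ∀ ρ ρ' : L ≃ₐ[ℚ] L, ρ r = ρ' r → ρ s = ρ' s → ρ = ρ' := by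
    intro ρ ρ' h1 h2
    have h3 : ρ u = ρ' u := mul_left_cancel₀ hd0 (by rw [hu, hu, h1, h2])
    ext y
    obtain ⟨a, b, c, e, rfl⟩ := h.span y
    simp [h1, h2, h3]
  have hpm : ∀ ρ : L ≃ₐ[ℚ] L, (ρ r = r ∨ ρ r = -r) ∧ (ρ s = s ∨ ρ s = -s) := by
    intro ρ
    refine ⟨sq_eq_sq_iff_eq_or_eq_neg.mp ?_, sq_eq_sq_iff_eq_or_eq_neg.mp ?_⟩
    · rw [← map_pow, h.left_sq]; simp
    · rw [← map_pow, h.right_sq]; simp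
  have hneg : ∀ x : L, x ≠ 0 → -x ≠ x := fun x hx => neg_ne_self.mpr hx
  refine ⟨?_, ?_, ?_, ?_, ?_, ?_, ?_⟩
  · apply hext <;> simp [h.σ_left, h.σ_right]
  · apply hext <;> simp [h.τ_left, h.τ_right]
  · apply hext <;> simp [h.σ_left, h.σ_right, h.τ_left, h.τ_right]
  · rintro rfl
    exact hneg r hr0 h.σ_left.symm
  · rintro rfl
    exact hneg s hs0 h.τ_right.symm
  · rintro rfl
    exact hneg r hr0 (h.σ_left.symm.trans h.τ_left)
  · intro ρ
    obtain ⟨h1 | h1, h2 | h2⟩ := hpm ρ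
    · exact Or.inl (hext _ _ h1 h2)
    · exact Or.inr (Or.inr (Or.inl (hext _ _ (h1.trans h.τ_left.symm) (h2.trans h.τ_right.symm))))
    · exact Or.inr (Or.inl (hext _ _ (h1.trans h.σ_left.symm) (h2.trans h.σ_right.symm)))
    · refine Or.inr (Or.inr (Or.inr (hext _ _ ?_ ?_))) <;>
        simp [h1, h2, h.σ_left, h.σ_right, h.τ_left, h.τ_right]

/-- A criterion for freeness with finitely many integrality conditions. -/
theorem isAssocOrderFree (h : IsBiquadratic d m' n' r s u σ τ) {σ' τ' : L ≃ₐ[ℚ] L}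
    (h' : IsKleinPair σ' τ') {t : L} (hσ : σ' t = -t) (hτ : τ' t = t) (g : L) (hg : IsIntegral ℤ g)
    (hgen : ∀ x₁ x₂ x₃ x₄ : ℤ, ∃ a b p q : ℚ, ∃ F : L → L,
      (∀ y, F y = a * y + b * τ' y + (p + q * t) * σ' y + (p - q * t) * σ' (τ' y)) ∧
      IsIntegral ℤ (F 1) ∧ IsIntegral ℤ (F r) ∧ IsIntegral ℤ (F s) ∧ IsIntegral ℤ (F ((s + u) / 2)) ∧
      F g = x₁ + x₂ * r + x₃ * s + x₄ * ((s + u) / 2)) :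
    IsAssocOrderFree L (nonclassicalSubgroup σ' τ') := by
  refine h'.isAssocOrderFree hσ hτ g hg fun x hx => ?_
  obtain ⟨x₁, x₂, x₃, x₄, rfl⟩ := (h.isIntegral_iff x).mp hx
  obtain ⟨a, b, p, q, F, hF, i1, i2, i3, i4, hFg⟩ := hgen x₁ x₂ x₃ x₄
  refine ⟨a, b, p, q, fun y hy => ?_, by rw [← hF, hFg]⟩
  rw [← hF]
  obtain ⟨y₁, y₂, y₃, y₄, rfl⟩ := (h.isIntegral_iff y).mp hy
  have : F (y₁ + y₂ * r + y₃ * s + y₄ * ((s + u) / 2)) =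
      y₁ * F 1 + y₂ * F r + y₃ * F s + y₄ * F ((s + u) / 2) := by
    simp only [hF, map_add, map_mul, map_intCast, map_one]
    ring
  rw [this]
  exact ((((isIntegral_intCast _).mul i1).add ((isIntegral_intCast _).mul i2)).add
    ((isIntegral_intCast _).mul i3)).add ((isIntegral_intCast _).mul i4)

end IsBiquadratic

end HopfGalois

/-! ### Explicit generators for the three structures -/

namespace HopfGalois

namespace IsBiquadratic

variable {L : Type*} [Field L] [NumberField L] {d m' n' : ℤ} {r s u : L} {σ τ : L ≃ₐ[ℚ] L}

theorem exists_eq_four_mul_add_three (h : IsBiquadratic d m' n' r s u σ τ) :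
    ∃ j : ℤ, d * m' = 4 * j + 3 := by
  have h0 : ((d * m' - 3 : ℤ) : ZMod 4) = 0 := by
    push_cast
    rw [h.left_mod, sub_self]
  obtain ⟨j, hj⟩ := (ZMod.intCast_zmod_eq_zero_iff_dvd (d * m' - 3) 4).mp h0
  push_cast at hj
  exact ⟨j, by linarith⟩

theorem isIntegral_of_eq (h : IsBiquadratic d m' n' r s u σ τ) {y : L} (a b c e : ℤ)
    (hy : y = a + b * r + c * s + e * ((s + u) / 2)) : IsIntegral ℤ y :=
  (h.isIntegral_iff y).mpr ⟨a, b, c, e, hy⟩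

/-- Here `t = r` and `J s = d u = u`, so the image of `s` alone reaches all of `ℚ s + ℚ u`. -/
theorem isAssocOrderFree_left_of_coprime (h : IsBiquadratic 1 m' n' r s u σ τ) :
    IsAssocOrderFree L (nonclassicalSubgroup σ τ) := by
  refine h.isAssocOrderFree h.isKleinPair h.σ_left h.τ_left (1 + r + s)
    (h.isIntegral_of_eq 1 1 1 0 (by push_cast; ring)) fun x₁ x₂ x₃ x₄ => ?_
  obtain ⟨j, hj⟩ := h.exists_eq_four_mul_add_three
  obtain rfl : m' = 4 * j + 3 := by linarith
  have rs := h.left_mul_right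
  have ru := h.left_mul_third
  push_cast at rs ru
  -- The solution of `F 1 = x₁`, `F r = x₂ r`, `F s = x₃ s + x₄ (s + u) / 2`.
  refine ⟨((x₁ + x₂) / 2 + (x₃ + x₄ / 2)) / 2, ((x₁ + x₂) / 2 - (x₃ + x₄ / 2)) / 2,
    (x₁ - x₂) / 4, x₄ / 4, _, fun y => rfl, h.isIntegral_of_eq x₁ 0 0 0 ?_,
    h.isIntegral_of_eq 0 x₂ 0 0 ?_, h.isIntegral_of_eq 0 0 x₃ x₄ ?_,
    h.isIntegral_of_eq 0 0 (-(j + 1) * x₄) (x₃ + x₄) ?_, ?_⟩ <;>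
  simp only [map_add, map_one, map_neg, map_div₀, map_ofNat, h.σ_left, h.σ_right, h.σ_third,
    h.τ_left, h.τ_right, h.τ_third] <;> push_cast
  · ring
  · ring
  · linear_combination (x₄ / 2 : L) * rs
  · linear_combination (x₄ / 4 : L) * rs - (x₄ / 4 : L) * ru
  · linear_combination (x₄ / 2 : L) * rs

/-- Now `J s = d u` may have a large factor, but `J u = -m' s = ±s`; hence `u` replaces `s` in the
generator. -/
theorem isAssocOrderFree_left_of_dvd (h : IsBiquadratic d m' n' r s u σ τ) (hm : m' ^ 2 = 1) :
    IsAssocOrderFree L (nonclassicalSubgroup σ τ) := by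
  refine h.isAssocOrderFree h.isKleinPair h.σ_left h.τ_left (1 + r + u)
    (h.isIntegral_of_eq 1 1 (-1) 2 (by push_cast; ring)) fun x₁ x₂ x₃ x₄ => ?_
  obtain ⟨j, hj⟩ := h.exists_eq_four_mul_add_three
  have rs := h.left_mul_right
  have ru := h.left_mul_third
  have hjL : (d : L) * m' = 4 * j + 3 := by exact_mod_cast congrArg (Int.cast : ℤ → L) hj
  have hmL : (m' : L) ^ 2 = 1 := by exact_mod_cast congrArg (Int.cast : ℤ → L) hm
  -- The solution of `F 1 = x₁`, `F r = x₂ r`, `F u = x₃ s + x₄ (s + u) / 2`, using `m'² = 1`.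
  refine ⟨((x₁ + x₂) / 2 + x₄ / 2) / 2, ((x₁ + x₂) / 2 - x₄ / 2) / 2,
    (x₁ - x₂) / 4, -m' * (x₃ + x₄ / 2) / 2, _, fun y => rfl, h.isIntegral_of_eq x₁ 0 0 0 ?_,
    h.isIntegral_of_eq 0 x₂ 0 0 ?_,
    h.isIntegral_of_eq 0 0 ((4 * j + 3) * x₃ + (2 * j + 2) * x₄) (-(4 * j + 3) * (2 * x₃ + x₄)) ?_,
    h.isIntegral_of_eq 0 0 ((2 * j + 2) * x₃ + (j + 1) * x₄)
      (-(4 * j + 3) * x₃ - (2 * j + 1) * x₄) ?_, ?_⟩ <;>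
  simp only [map_add, map_one, map_neg, map_div₀, map_ofNat, h.σ_left, h.σ_right, h.σ_third,
    h.τ_left, h.τ_right, h.τ_third] <;> push_cast
  · ring
  · ring
  · linear_combination (-m' * (x₃ + x₄ / 2) : L) * rs - (x₃ + x₄ / 2 : L) * u * hjL
  · linear_combination (-m' * (x₃ + x₄ / 2) / 2 : L) * rs - (x₃ + x₄ / 2 : L) * u / 2 * hjL
      + (m' * (x₃ + x₄ / 2) / 2 : L) * ru + (x₃ + x₄ / 2 : L) * s / 2 * hmL
  · linear_combination (m' * (x₃ + x₄ / 2) : L) * ru + (x₃ + x₄ / 2 : L) * s * hmL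

/-- Here `t = s` and `J u = -n' r = -2ε r`; the factor 2 cancels the denominator of `(s + u) / 2` in
the generator. -/
theorem isAssocOrderFree_right (h : IsBiquadratic d m' n' r s u σ τ) {ε : ℤ} (hn : n' = 2 * ε)
    (hε : ε ^ 2 = 1) : IsAssocOrderFree L (nonclassicalSubgroup τ σ) := by
  subst hn
  refine h.isAssocOrderFree h.isKleinPair.swap h.τ_right h.σ_right (1 + (s + u) / 2)
    (h.isIntegral_of_eq 1 0 0 1 (by push_cast; ring)) fun x₁ x₂ x₃ x₄ => ?_
  have rs := h.left_mul_right
  have su := h.right_mul_third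
  have hεL : (ε : L) ^ 2 = 1 := by exact_mod_cast congrArg (Int.cast : ℤ → L) hε
  push_cast at su
  -- The solution of `F 1 = x₁`, `F s = (2x₃ + x₄) s`, `F u = x₄ u + 2x₂ r`.
  refine ⟨((x₁ + (2 * x₃ + x₄)) / 2 + x₄) / 2, ((x₁ + (2 * x₃ + x₄)) / 2 - x₄) / 2,
    (x₁ - (2 * x₃ + x₄)) / 4, -ε * x₂ / 2, _, fun y => rfl, h.isIntegral_of_eq x₁ 0 0 0 ?_,
    h.isIntegral_of_eq 0 x₄ (ε * d * x₂) (-2 * ε * d * x₂) ?_,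
    h.isIntegral_of_eq 0 0 (2 * x₃ + x₄) 0 ?_, h.isIntegral_of_eq 0 x₂ x₃ x₄ ?_, ?_⟩ <;>
  simp only [map_add, map_one, map_neg, map_div₀, map_ofNat, h.σ_left, h.σ_right, h.σ_third,
    h.τ_left, h.τ_right, h.τ_third] <;> push_cast
  · ring
  · linear_combination (-ε * x₂ : L) * rs
  · ring
  · linear_combination (ε * x₂ / 2 : L) * su + (x₂ : L) * r * hεL
  · linear_combination (ε * x₂ / 2 : L) * su + (x₂ : L) * r * hεL

/-- Here `t = u` and `J s = n' r = 2ε r`, so `s` and `u` exchange roles while the generator stays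
the same. -/
theorem isAssocOrderFree_third (h : IsBiquadratic d m' n' r s u σ τ) {ε : ℤ} (hn : n' = 2 * ε)
    (hε : ε ^ 2 = 1) : IsAssocOrderFree L (nonclassicalSubgroup σ (σ * τ)) := by
  subst hn
  refine h.isAssocOrderFree h.isKleinPair.left_mul h.σ_third
    (by simp [h.τ_third, h.σ_third]) (1 + (s + u) / 2)
    (h.isIntegral_of_eq 1 0 0 1 (by push_cast; ring)) fun x₁ x₂ x₃ x₄ => ?_
  have ru := h.left_mul_third
  have su := h.right_mul_third
  have hεL : (ε : L) ^ 2 = 1 := by exact_mod_cast congrArg (Int.cast : ℤ → L) hε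
  push_cast at su
  -- The solution of `F 1 = x₁`, `F u = x₄ u`, `F s = (2x₃ + x₄) s + 2x₂ r`.
  refine ⟨((x₁ + x₄) / 2 + (2 * x₃ + x₄)) / 2, ((x₁ + x₄) / 2 - (2 * x₃ + x₄)) / 2,
    (x₁ - x₄) / 4, ε * x₂ / 2, _, fun y => rfl, h.isIntegral_of_eq x₁ 0 0 0 ?_,
    h.isIntegral_of_eq 0 (2 * x₃ + x₄) (-ε * m' * x₂) 0 ?_,
    h.isIntegral_of_eq 0 (2 * x₂) (2 * x₃ + x₄) 0 ?_, h.isIntegral_of_eq 0 x₂ x₃ x₄ ?_, ?_⟩ <;>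
  simp only [AlgEquiv.mul_apply, map_add, map_one, map_neg, map_div₀, map_ofNat, h.σ_left,
    h.σ_right, h.σ_third, h.τ_left, h.τ_right, h.τ_third] <;> push_cast
  · ring
  · linear_combination (-ε * x₂ : L) * ru
  · linear_combination (ε * x₂ : L) * su + 2 * (x₂ : L) * r * hεL
  · linear_combination (ε * x₂ / 2 : L) * su + (x₂ : L) * r * hεL
  · linear_combination (ε * x₂ / 2 : L) * su + (x₂ : L) * r * hεL

end IsBiquadratic

/-! ### Reduction of the given field to the normal form -/

theorem exists_rat_combination {L : Type*} [Field L] [NumberField L] {r s : L} {m n : ℤ}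
    (hr : r ^ 2 = (m : L)) (hs : s ^ 2 = (n : L)) (hL : IntermediateField.adjoin ℚ {r, s} = ⊤)
    (y : L) : ∃ a b c e : ℚ, y = a + b * r + c * s + e * (r * s) := by
  let S : Subalgebra ℚ L :=
    { carrier := {y | ∃ a b c e : ℚ, y = a + b * r + c * s + e * (r * s)}
      mul_mem' := by
        rintro _ _ ⟨a, b, c, e, rfl⟩ ⟨a', b', c', e', rfl⟩
        refine ⟨a * a' + m * b * b' + n * c * c' + m * n * e * e',
          a * b' + b * a' + n * (c * e' + e * c'), a * c' + c * a' + m * (b * e' + e * b'),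
          a * e' + e * a' + b * c' + c * b', ?_⟩
        push_cast
        linear_combination ((b : L) * b' + (b * e' + e * b') * s + e * e' * s ^ 2) * hr +
          ((c : L) * c' + (c * e' + e * c') * r + e * e' * m) * hs
      add_mem' := by
        rintro _ _ ⟨a, b, c, e, rfl⟩ ⟨a', b', c', e', rfl⟩
        exact ⟨a + a', b + b', c + c', e + e', by push_cast; ring⟩
      algebraMap_mem' := fun q => ⟨q, 0, 0, 0, by simp⟩ }
  have hle : Algebra.adjoin ℚ {r, s} ≤ S := by
    rw [Algebra.adjoin_le_iff]
    rintro x (rfl | rfl)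
    · exact ⟨0, 1, 0, 0, by simp⟩
    · exact ⟨0, 0, 1, 0, by simp⟩
  -- `L` is algebraic over `ℚ`, so the field generated by `r` and `s` is already the algebra they
  -- generate.
  have hy : y ∈ (IntermediateField.adjoin ℚ {r, s}).toSubalgebra := by
    rw [hL]
    exact IntermediateField.mem_top
  rw [IntermediateField.adjoin_toSubalgebra] at hy
  exact hle hy

theorem isBiquadratic_of_gcd {m n d m' n' : ℤ} (hm : Squarefree m) (hn : Squarefree n)
    (hm4 : m ≡ 3 [ZMOD 4]) (hn4 : n ≡ 2 [ZMOD 4]) (hmd : m = d * m') (hnd : n = d * n')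
    (hcop : IsCoprime m' n')
    {L : Type*} [Field L] [NumberField L] {r s : L} (hr : r ^ 2 = (m : L)) (hs : s ^ 2 = (n : L))
    (hL : IntermediateField.adjoin ℚ {r, s} = ⊤)
    {σ τ : L ≃ₐ[ℚ] L} (hσr : σ r = -r) (hσs : σ s = s) (hτr : τ r = r) (hτs : τ s = -s) :
    IsBiquadratic d m' n' r s (r * s / d) σ τ := by
  have hz {a b : ℤ} (h : a ≡ b [ZMOD 4]) : (a : ZMod 4) = b := (ZMod.intCast_eq_intCast_iff a b 4).mpr h
  have hd0 : (d : L) ≠ 0 := by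
    rintro e
    rw [Int.cast_eq_zero] at e
    exact hm.ne_zero (by rw [hmd, e, zero_mul])
  have hr' : r ^ 2 = (d : L) * m' := by rw [hr, hmd]; push_cast; rfl
  have hs' : s ^ 2 = (d : L) * n' := by rw [hs, hnd]; push_cast; rfl
  refine
    { squarefree_left := hmd ▸ hm
      squarefree_right := hnd ▸ hn
      squarefree_mul := squarefree_mul_iff.mpr ⟨hcop.isRelPrime,
        hm.squarefree_of_dvd ⟨d, by rw [hmd, mul_comm]⟩,
        hn.squarefree_of_dvd ⟨d, by rw [hnd, mul_comm]⟩⟩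
      left_mod := by exact_mod_cast hz (hmd ▸ hm4)
      right_mod := by exact_mod_cast hz (hnd ▸ hn4)
      left_sq := hr'
      right_sq := hs'
      third_sq := ?_
      left_mul_right := by field_simp
      left_mul_third := ?_
      right_mul_third := ?_
      σ_left := hσr
      σ_right := hσs
      σ_third := by simp [hσr, hσs, neg_div]
      τ_left := hτr
      τ_right := hτs
      τ_third := by simp [hτr, hτs, neg_div]
      span := fun y => ?_ }
  · rw [div_pow, mul_pow, hr', hs']
    field_simp
  · rw [mul_div_assoc', ← mul_assoc, ← sq, hr']
    field_simp
  · rw [mul_div_assoc', mul_left_comm, ← sq, hs']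
    field_simp
  · obtain ⟨a, b, c, e, rfl⟩ := exists_rat_combination hr hs hL y
    refine ⟨a, b, c, e * d, ?_⟩
    push_cast
    field_simp

end HopfGalois

/-- `L = ℚ(√m, √n)` with `r = √m`, `s = √n`, and `Gal(L/ℚ) = {1, σ, τ, στ}`, where `σ`, `τ`, `στ` fix
`√n`, `√m`, `√k` respectively, `k = mn / gcd(m, n)^2`. The subgroups attached to
`⟨τ⟩`, `⟨σ⟩`, `⟨στ⟩` give the Hopf-Galois structures `H₁`, `H₂`, `H₃`. -/
theorem mainTheorem4 (m n : ℤ) (hm : Squarefree m) (hn : Squarefree n)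
    (hm4 : m ≡ 3 [ZMOD 4]) (hn4 : n ≡ 2 [ZMOD 4])
    (L : Type*) [Field L] [NumberField L] (r s : L) (hr : r ^ 2 = (m : L)) (hs : s ^ 2 = (n : L))
    (hL : IntermediateField.adjoin ℚ {r, s} = ⊤)
    (σ τ : L ≃ₐ[ℚ] L) (hσr : σ r = -r) (hσs : σ s = s) (hτr : τ r = r) (hτs : τ s = -s) :
    ((IsCoprime m n ∨ m ∣ n) →
      HopfGalois.IsAssocOrderFree L (HopfGalois.nonclassicalSubgroup σ τ)) ∧
    ((n = 2 * (Int.gcd m n : ℤ) ∨ n = -(2 * (Int.gcd m n : ℤ))) →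
      HopfGalois.IsAssocOrderFree L (HopfGalois.nonclassicalSubgroup τ σ) ∧
      HopfGalois.IsAssocOrderFree L (HopfGalois.nonclassicalSubgroup σ (σ * τ))) := by
  have hd0 : (Int.gcd m n : ℤ) ≠ 0 := fun e =>
    hm.ne_zero (Int.gcd_eq_zero_iff.mp (by exact_mod_cast e)).1
  obtain ⟨m', hmd⟩ := Int.gcd_dvd_left m n
  obtain ⟨n', hnd⟩ := Int.gcd_dvd_right m n
  have hcop : IsCoprime m' n' := by
    have hb := Int.gcd_eq_gcd_ab m n
    refine ⟨Int.gcdA m n, Int.gcdB m n, mul_left_cancel₀ hd0 ?_⟩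
    linear_combination -hb - Int.gcdA m n * hmd - Int.gcdB m n * hnd
  have h := HopfGalois.isBiquadratic_of_gcd hm hn hm4 hn4 hmd hnd hcop hr hs hL hσr hσs hτr hτs
  refine ⟨fun hmn => ?_, fun h2 => ?_⟩
  · rcases hmn with hc | hdvd
    · rw [Int.isCoprime_iff_gcd_eq_one.mp hc] at h
      exact h.isAssocOrderFree_left_of_coprime
    · refine h.isAssocOrderFree_left_of_dvd ?_
      -- If `m` divides `n`, then `d m' = m` divides `d`, so `m'` is a unit.
      obtain ⟨c, hc⟩ : m ∣ (Int.gcd m n : ℤ) := Int.dvd_coe_gcd dvd_rfl hdvd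
      refine Int.isUnit_sq (IsUnit.of_mul_eq_one c (mul_left_cancel₀ hd0 ?_))
      linear_combination -hc - c * hmd
  · obtain ⟨ε, hε, hn'⟩ : ∃ ε : ℤ, ε ^ 2 = 1 ∧ n' = 2 * ε := by
      rcases h2 with h2 | h2
      · exact ⟨1, by norm_num, mul_left_cancel₀ hd0 (by rw [← hnd]; linarith)⟩
      · exact ⟨-1, by norm_num, mul_left_cancel₀ hd0 (by rw [← hnd]; linarith)⟩
    exact ⟨h.isAssocOrderFree_right hn' hε, h.isAssocOrderFree_third hn' hε⟩
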